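/- Let $a, b$ be distinct non-constant polynomials in $\mathbb{F}_2[z]$. Let $\mathbf{t} = t_0 t_1 t_2 \ldots = abbabaab\ldots$ be the Thue--Morse sequence over $\{a,b\}$, defined by $t_0 = a$ and, for $k \ge 0$, $t_{2k} = t_k$ and $t_{2k+1} = a$ if $t_k = b$, $t_{2k+1} = b$ if $t_k = a$. The continued fraction $$\xi_{a,b} = [0; t_0, t_1, t_2, \ldots] = [0; a, b, b, a, b, a, a, b, \ldots]$$ converges in $\mathbb{F}_2((z^{-1}))$, and its value $\xi_{a,b}$ is algebraic of degree exactly $4$ over $\mathbb{F}_2(z)$. More precisely, setting \begin{align*} A_0&=b(a+b)(a^2 b^2 +a^2+b^2) + a^2 b^4, \\ A_1&=ab(a+b) (a^2 b^2 + a^2 + b^2), \\ A_2&=a^2 b^2 (a^2 b^2+a^2+b^2), \\ A_3&=A_1, \\ A_4&=a(a+b)(a^2 b^2 +a^2+b^2)+ a^2 b^4, \end{align*} we have $$A_4 \xi_{a, b}^4 + A_3 \xi_{a, b}^3 + A_2 \xi_{a, b}^2 + A_1 \xi_{a, b} + A_0 = 0.$$ -/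

import Mathlib

open Polynomial Filter Topology

noncomputable section

/-- The Thue–Morse sequence over `{false, true}`: `t 0 = false`, `t (2k) = t k` and
`t (2k+1)` is the letter different from `t k`. -/
def thueMorse : ℕ → Bool
  | 0 => false
  | n + 1 =>
    if (n + 1) % 2 = 0 then thueMorse ((n + 1) / 2) else !(thueMorse ((n + 1) / 2))

theorem thueMorse_zero : thueMorse 0 = false := by
  rw [thueMorse]

theorem thueMorse_two_mul (k : ℕ) : thueMorse (2 * k) = thueMorse k := by
  rcases k with _ | k
  · rfl
  · have h : 2 * (k + 1) = (2 * k + 1) + 1 := by ring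
    rw [h, thueMorse, if_pos (by omega)]
    congr 1
    omega

theorem thueMorse_two_mul_add_one (k : ℕ) : thueMorse (2 * k + 1) = !(thueMorse k) := by
  rw [thueMorse, if_neg (by omega)]
  congr 2
  omega

/-- The Thue–Morse sequence `a b b a b a a b ⋯` over the alphabet `{a, b}`. -/
def thueMorseWord {α : Type*} (a b : α) (n : ℕ) : α :=
  if thueMorse n then b else a

open scoped Classical in
/-- The field `𝔽₂((z⁻¹))`, that is, the completion of `𝔽₂(z)` at the place at infinity
(`|P / Q| = 2 ^ (deg P - deg Q)`), with its topology and its `𝔽₂(z)`-algebra structure. -/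
abbrev SeriesAtInfty : Type := RatFunc.CompletionAtInfty (ZMod 2)

/-- The embedding of `𝔽₂[z]` into `𝔽₂((z⁻¹))`. -/
def polyToSeries : (ZMod 2)[X] →+* SeriesAtInfty :=
  (algebraMap (RatFunc (ZMod 2)) SeriesAtInfty).comp
    (algebraMap (ZMod 2)[X] (RatFunc (ZMod 2)))

/-- The infinite simple continued fraction `[0; a, b, b, a, b, a, a, b, ⋯]` (a formal object) whose
partial quotients follow the Thue–Morse sequence over `{a, b}`. -/
def thueMorseContFract (a b : (ZMod 2)[X]) : GenContFract SeriesAtInfty where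
  h := 0
  s := Stream'.Seq.ofStream fun n => ⟨1, polyToSeries (thueMorseWord a b n)⟩

/-- The value of the Thue–Morse continued fraction in `𝔽₂((z⁻¹))`: the limit of its convergents. -/
def thueMorseSeries (a b : (ZMod 2)[X]) : SeriesAtInfty :=
  limUnder atTop (thueMorseContFract a b).convs

/-- The coefficient `A₀`. -/
def coeffA0 (a b : (ZMod 2)[X]) : (ZMod 2)[X] :=
  b * (a + b) * (a ^ 2 * b ^ 2 + a ^ 2 + b ^ 2) + a ^ 2 * b ^ 4

/-- The coefficient `A₁`. -/
def coeffA1 (a b : (ZMod 2)[X]) : (ZMod 2)[X] :=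
  a * b * (a + b) * (a ^ 2 * b ^ 2 + a ^ 2 + b ^ 2)

/-- The coefficient `A₂`. -/
def coeffA2 (a b : (ZMod 2)[X]) : (ZMod 2)[X] :=
  a ^ 2 * b ^ 2 * (a ^ 2 * b ^ 2 + a ^ 2 + b ^ 2)

/-- The coefficient `A₃`, equal to `A₁`. -/
def coeffA3 (a b : (ZMod 2)[X]) : (ZMod 2)[X] := coeffA1 a b

/-- The coefficient `A₄`. -/
def coeffA4 (a b : (ZMod 2)[X]) : (ZMod 2)[X] :=
  a * (a + b) * (a ^ 2 * b ^ 2 + a ^ 2 + b ^ 2) + a ^ 2 * b ^ 4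

end

/-! Self-similarity and Frobenius carry the proof. The continuant matrix of a prefix of length
4^(k+1) is M N N M, where M and N are those of length 4^k for (a, b) and (b, a). In characteristic 2
this recursion preserves the shape c • B(t): with m = ab(a²b² + a² + b²), it sends t to 1 + t⁴/m and
c to m²c⁴ (`blockMatrix_mul`). The t_n converge to a root T of X⁴ + mX + m, so ξ = B(T)₁₀ / B(T)₀₀.

Since det B(T) = T⁴ + mT + m = 0, the rows of B(T) are proportional. The resulting two relations
between ξ and T express T rationally in ξ (`add_mul_sq_add_one_mul_eq`); eliminating T gives the
stated quartic. Hence ξ and T generate the same field over 𝔽₂(z), of degree 4 because X⁴ + mX + m is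
irreducible (`blockQuartic_irreducible`). -/

noncomputable section

/-! ### Continuant matrices of Thue–Morse prefixes -/

variable {R : Type*} [CommRing R]

/-- The matrix product `∏ i < n, !![f i, 1; 1, 0]` of a continued fraction. -/
def contProd (f : ℕ → R) : ℕ → Matrix (Fin 2) (Fin 2) R
  | 0 => 1
  | n + 1 => contProd f n * !![f n, 1; 1, 0]

theorem contProd_congr {f g : ℕ → R} {n : ℕ} (h : ∀ i < n, f i = g i) :
    contProd f n = contProd g n := by
  induction n with
  | zero => rfl
  | succ n ih =>
    rw [contProd, contProd, ih fun i hi => h i (by omega), h n (by omega)]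

theorem contProd_add (f : ℕ → R) (m n : ℕ) :
    contProd f (m + n) = contProd f m * contProd (fun i => f (m + i)) n := by
  induction n with
  | zero => simp [contProd]
  | succ n ih => rw [← add_assoc, contProd, ih, contProd, Matrix.mul_assoc]

theorem thueMorse_two_pow_add (k i : ℕ) (hi : i < 2 ^ k) :
    thueMorse (2 ^ k + i) = !(thueMorse i) := by
  induction k generalizing i with
  | zero =>
    obtain rfl : i = 0 := by simpa using hi
    simpa using thueMorse_two_mul_add_one 0
  | succ k ih =>
    rw [pow_succ] at hi
    obtain ⟨j, rfl | rfl⟩ := Nat.even_or_odd' i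
    · rw [show 2 ^ (k + 1) + 2 * j = 2 * (2 ^ k + j) by ring, thueMorse_two_mul,
        thueMorse_two_mul, ih j (by omega)]
    · rw [show 2 ^ (k + 1) + (2 * j + 1) = 2 * (2 ^ k + j) + 1 by ring,
        thueMorse_two_mul_add_one, thueMorse_two_mul_add_one, ih j (by omega)]

theorem thueMorseWord_two_pow_add {α : Type*} (a b : α) (k i : ℕ) (hi : i < 2 ^ k) :
    thueMorseWord a b (2 ^ k + i) = thueMorseWord b a i := by
  simp only [thueMorseWord, thueMorse_two_pow_add k i hi]
  cases thueMorse i <;> simp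

theorem contProd_thueMorseWord_two_pow_succ (a b : R) (k : ℕ) :
    contProd (thueMorseWord a b) (2 ^ (k + 1)) =
      contProd (thueMorseWord a b) (2 ^ k) * contProd (thueMorseWord b a) (2 ^ k) := by
  rw [pow_succ, mul_two, contProd_add]
  congr 1
  exact contProd_congr fun i hi => thueMorseWord_two_pow_add a b k i hi

theorem contProd_thueMorseWord_four_mul (a b : R) (k : ℕ) :
    contProd (thueMorseWord a b) (2 ^ (k + 2)) =
      contProd (thueMorseWord a b) (2 ^ k) * contProd (thueMorseWord b a) (2 ^ k) *
        (contProd (thueMorseWord b a) (2 ^ k) * contProd (thueMorseWord a b) (2 ^ k)) := by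
  rw [contProd_thueMorseWord_two_pow_succ, contProd_thueMorseWord_two_pow_succ,
    contProd_thueMorseWord_two_pow_succ]

/-! ### The block recursion in characteristic 2 -/

/-- The constant coefficient of the quartic `T ^ 4 + m * T + m`. -/
def thueMorseDisc (a b : R) : R := a * b * (a ^ 2 * b ^ 2 + a ^ 2 + b ^ 2)

theorem thueMorseDisc_comm (a b : R) : thueMorseDisc b a = thueMorseDisc a b := by
  unfold thueMorseDisc; ring

/-- The shape of the normalized continuant matrices of Thue–Morse prefixes of length `4 ^ n`. -/
def blockMatrix (a b t : R) : Matrix (Fin 2) (Fin 2) R :=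
  !![t ^ 2 + a * b * t + a ^ 2 * b ^ 2 + a ^ 2 + a * b, a * b ^ 2 + (a + b) * t;
     a * b ^ 2 + (a + b) * t, t ^ 2 + a * b * t + a * b + b ^ 2]

variable {L : Type*} [Field L]

/-- The scale factors of the continuant matrices of Thue–Morse prefixes of length `4 ^ n`. -/
def blockScale {R : Type*} [CommRing R] (m : R) : ℕ → R
  | 0 => 1
  | n + 1 => m ^ 2 * blockScale m n ^ 4

/-- The iterates of `t ↦ 1 + t ^ 4 / m`. -/
def blockParam (m : L) : ℕ → L
  | 0 => 1
  | n + 1 => 1 + blockParam m n ^ 4 / m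

/-- The hypothesis is u = 1 + t⁴/m cleared of its denominator. After multiplication by m², u enters
only through m²u and m²u², so the claim becomes a polynomial identity in a, b, t modulo 2. -/
theorem blockMatrix_mul (h2 : (2 : L) = 0) (a b t u : L)
    (h : thueMorseDisc a b * u = thueMorseDisc a b + t ^ 4) :
    blockMatrix a b t * blockMatrix b a t * (blockMatrix b a t * blockMatrix a b t) =
      thueMorseDisc a b ^ 2 • blockMatrix a b u := by
  have : CharP L 2 := CharTwo.of_one_ne_zero_of_two_eq_zero one_ne_zero h2
  have hm : thueMorseDisc a b = a * b * (a ^ 2 * b ^ 2 + a ^ 2 + b ^ 2) := rfl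
  generalize thueMorseDisc a b = m at h hm ⊢
  have h' : m ^ 2 * u ^ 2 = (m + t ^ 4) ^ 2 := by rw [← h]; ring
  have h'' : m ^ 2 * u = m * (m + t ^ 4) := by rw [← h]; ring
  rw [blockMatrix, blockMatrix, blockMatrix]
  simp only [Matrix.mul_fin_two]
  ext i j
  fin_cases i <;> fin_cases j <;> simp <;>
    simp only [mul_add, mul_left_comm (m ^ 2), h', h''] <;> subst hm
  all_goals
    ring_nf
    reduce_mod_char!

theorem contProd_thueMorseWord_four (h2 : (2 : L) = 0) (a b : L) :
    contProd (thueMorseWord a b) (2 ^ 2) = blockMatrix a b 1 := by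
  have : CharP L 2 := CharTwo.of_one_ne_zero_of_two_eq_zero one_ne_zero h2
  have t1 : thueMorse 1 = true := by simpa [thueMorse_zero] using thueMorse_two_mul_add_one 0
  have t2 : thueMorse 2 = true := by simpa [t1] using thueMorse_two_mul 1
  have t3 : thueMorse 3 = false := by simpa [t1] using thueMorse_two_mul_add_one 1
  simp only [contProd, thueMorseWord, thueMorse_zero, t1, t2, t3, blockMatrix, Nat.reducePow,
    one_mul, Matrix.mul_fin_two, if_true, Bool.false_eq_true, if_false]
  ext i j
  fin_cases i <;> fin_cases j <;> simp <;> ring_nf <;> reduce_mod_char!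

theorem contProd_thueMorseWord_eq_smul_blockMatrix (h2 : (2 : L) = 0) (a b : L)
    (hm : thueMorseDisc a b ≠ 0) (n : ℕ) :
    contProd (thueMorseWord a b) (2 ^ (2 * n + 2)) =
      blockScale (thueMorseDisc a b) n • blockMatrix a b (blockParam (thueMorseDisc a b) n) := by
  -- The recursion also needs the swapped pair (b, a); scale and parameter are common to both
  -- because m is symmetric.
  induction n generalizing a b with
  | zero =>
    rw [mul_zero, zero_add, contProd_thueMorseWord_four h2, blockScale, blockParam, one_smul]
  | succ n ih =>
    have hm' : thueMorseDisc b a ≠ 0 := by rwa [thueMorseDisc_comm]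
    rw [show 2 * (n + 1) + 2 = 2 * n + 2 + 2 by ring, contProd_thueMorseWord_four_mul,
      ih a b hm, ih b a hm', thueMorseDisc_comm a b]
    simp only [Matrix.smul_mul, Matrix.mul_smul, smul_smul]
    rw [blockMatrix_mul h2 a b _ (blockParam (thueMorseDisc a b) (n + 1)), smul_smul, blockScale]
    · congr 1; ring
    · rw [blockParam]; field_simp

/-- This reflects that a continuant matrix of even length has determinant 1, the second factor being
det B(t). -/
theorem blockScale_sq_mul (h2 : (2 : L) = 0) {m : L} (hm : m ≠ 0) (n : ℕ) :
    blockScale m n ^ 2 * (blockParam m n ^ 4 + m * blockParam m n + m) = 1 := by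
  induction n with
  | zero => simp only [blockScale, blockParam]; linear_combination m * h2
  | succ n ih =>
    have h : m * blockParam m (n + 1) = m + blockParam m n ^ 4 := by
      rw [blockParam]; field_simp
    rw [blockScale]
    have h4 : m ^ 4 * blockParam m (n + 1) ^ 4 = (m + blockParam m n ^ 4) ^ 4 := by rw [← h]; ring
    have : CharP L 2 := CharTwo.of_one_ne_zero_of_two_eq_zero one_ne_zero h2
    generalize blockParam m (n + 1) = t' at *
    generalize blockParam m n = t at *
    generalize blockScale m n = c at *
    -- Frobenius: the quartic at the next iterate is, up to m⁴, the fourth power of the quartic at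
    -- t. The induction then uses y⁴ - 1 = (y³ + y² + y + 1)(y - 1).
    have key : m ^ 4 * (t' ^ 4 + m * t' + m) = (t ^ 4 + m * t + m) ^ 4 := by
      rw [mul_add, mul_add, h4, h]
      ring_nf
      reduce_mod_char!
    linear_combination c ^ 8 * key + ((c ^ 2 * (t ^ 4 + m * t + m)) ^ 3 +
      (c ^ 2 * (t ^ 4 + m * t + m)) ^ 2 + c ^ 2 * (t ^ 4 + m * t + m) + 1) * ih

theorem blockParam_succ_sub (h2 : (2 : L) = 0) {m : L} (hm : m ≠ 0) (n : ℕ) :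
    blockParam m (n + 1) - blockParam m n = (m * blockScale m n ^ 2)⁻¹ := by
  have h := blockScale_sq_mul h2 hm n
  have hc : blockScale m n ≠ 0 := by
    intro h0; simp [h0] at h
  rw [blockParam]
  field_simp
  linear_combination h - blockScale m n ^ 2 * m * blockParam m n * h2

/-! ### Convergents and degrees of continuants -/

/-- The integer part is 0, so numerators sit in the second row and denominators in the first. -/
theorem contsAux_ofStream (f : ℕ → L) (n : ℕ) :
    let g : GenContFract L := ⟨0, Stream'.Seq.ofStream fun n => ⟨1, f n⟩⟩
    g.contsAux n = ⟨contProd f n 1 1, contProd f n 0 1⟩ ∧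
      g.contsAux (n + 1) = ⟨contProd f n 1 0, contProd f n 0 0⟩ := by
  intro g
  induction n with
  | zero => simp [contProd, g]
  | succ n ih =>
    have hs : g.s.get? n = some ⟨1, f n⟩ := rfl
    refine ⟨?_, ?_⟩
    · rw [ih.2]
      simp [contProd, Matrix.mul_apply, Fin.sum_univ_two]
    · rw [GenContFract.contsAux_recurrence hs ih.1 ih.2]
      simp [contProd, Matrix.mul_apply, Fin.sum_univ_two, mul_comm]

theorem convs_ofStream (f : ℕ → L) (n : ℕ) :
    (⟨0, Stream'.Seq.ofStream fun n => ⟨1, f n⟩⟩ : GenContFract L).convs n =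
      contProd f n 1 0 / contProd f n 0 0 := by
  rw [GenContFract.conv_eq_conts_a_div_conts_b, GenContFract.nth_cont_eq_succ_nth_contAux,
    (contsAux_ofStream f n).2]

theorem convs_ofStream_succ_sub (f : ℕ → L) (n : ℕ) (hn : contProd f n 0 0 ≠ 0)
    (hn' : contProd f (n + 1) 0 0 ≠ 0) :
    contProd f (n + 1) 1 0 / contProd f (n + 1) 0 0 - contProd f n 1 0 / contProd f n 0 0 =
      (-1) ^ n / (contProd f n 0 0 * contProd f (n + 1) 0 0) := by
  have hdet : (contProd f (n + 1)).det = (-1) ^ (n + 1) := by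
    generalize n + 1 = k
    induction k with
    | zero => simp [contProd]
    | succ k ih => rw [contProd, Matrix.det_mul, ih, Matrix.det_fin_two_of]; ring
  have h0 : contProd f (n + 1) 0 1 = contProd f n 0 0 := by
    simp [contProd, Matrix.mul_apply, Fin.sum_univ_two]
  have h1 : contProd f (n + 1) 1 1 = contProd f n 1 0 := by
    simp [contProd, Matrix.mul_apply, Fin.sum_univ_two]
  rw [Matrix.det_fin_two, h0, h1] at hdet
  field_simp
  linear_combination -hdet

theorem map_contProd {R S : Type*} [CommRing R] [CommRing S] (φ : R →+* S) (f : ℕ → R) (n : ℕ) :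
    contProd (fun i => φ (f i)) n = (contProd f n).map φ := by
  induction n with
  | zero => simp [contProd]
  | succ n ih =>
    rw [contProd, contProd, ih, Matrix.map_mul]
    congr 1
    ext i j
    fin_cases i <;> fin_cases j <;> simp

theorem map_thueMorseWord {α β : Type*} (φ : α → β) (a b : α) :
    (fun i => φ (thueMorseWord a b i)) = thueMorseWord (φ a) (φ b) := by
  funext i
  simp only [thueMorseWord, apply_ite φ]

theorem natDegree_contProd {k : Type*} [Field k] (f : ℕ → k[X]) (hf : ∀ n, 0 < (f n).natDegree)
    (n : ℕ) : n ≤ (contProd f n 0 0).natDegree ∧ contProd f n 0 0 ≠ 0 := by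
  -- The strict degree drop rules out cancellation of leading terms in the recurrence.
  suffices h : n ≤ (contProd f n 0 0).natDegree ∧
      (contProd f n 0 1).degree < (contProd f n 0 0).degree from
    ⟨h.1, fun h0 => by simp [h0] at h⟩
  induction n with
  | zero => simp [contProd]
  | succ n ih =>
    obtain ⟨ih1, ih2⟩ := ih
    have h0 : contProd f n 0 0 ≠ 0 := fun h0 => by simp [h0] at ih2
    have hf0 : f n ≠ 0 := fun h => by simpa [h] using hf n
    have e1 : contProd f (n + 1) 0 1 = contProd f n 0 0 := by
      simp [contProd, Matrix.mul_apply, Fin.sum_univ_two]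
    have e0 : contProd f (n + 1) 0 0 = contProd f n 0 0 * f n + contProd f n 0 1 := by
      simp [contProd, Matrix.mul_apply, Fin.sum_univ_two]
    have hlt : (contProd f n 0 0).degree < (contProd f n 0 0 * f n).degree := by
      rw [degree_eq_natDegree h0, degree_eq_natDegree (mul_ne_zero h0 hf0), natDegree_mul h0 hf0]
      have := hf n
      exact_mod_cast (by omega)
    have hd : (contProd f (n + 1) 0 0).degree = (contProd f n 0 0 * f n).degree := by
      rw [e0, degree_add_eq_left_of_degree_lt (ih2.trans hlt)]
    refine ⟨?_, by rwa [e1, hd]⟩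
    rw [natDegree_eq_of_degree_eq hd, natDegree_mul h0 hf0]
    have := hf n
    omega

theorem map_blockScale {R S : Type*} [CommRing R] [CommRing S] (φ : R →+* S) (m : R) (n : ℕ) :
    φ (blockScale m n) = blockScale (φ m) n := by
  induction n with
  | zero => simp [blockScale]
  | succ n ih => simp [blockScale, ih]

theorem natDegree_blockScale {k : Type*} [Field k] (m : k[X]) (hm : 0 < m.natDegree) (n : ℕ) :
    n ≤ (blockScale m n).natDegree ∧ blockScale m n ≠ 0 := by
  have hm0 : m ≠ 0 := fun h => by simp [h] at hm
  induction n with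
  | zero => simp [blockScale]
  | succ n ih =>
    refine ⟨?_, ?_⟩
    · rw [blockScale, natDegree_mul (pow_ne_zero _ hm0) (pow_ne_zero _ ih.2), natDegree_pow,
        natDegree_pow]
      omega
    · exact mul_ne_zero (pow_ne_zero _ hm0) (pow_ne_zero _ ih.2)

/-! ### Topology of 𝔽₂((z⁻¹)) -/

open scoped Classical RatFunc.CompletionAtInfty in
instance : CompleteSpace SeriesAtInfty :=
  letI := RatFunc.inftyValued (ZMod 2)
  inferInstanceAs (CompleteSpace (UniformSpace.Completion (RatFunc (ZMod 2))))

theorem nonarchimedeanRing_of_valued {K Γ₀ : Type*} [Ring K]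
    [LinearOrderedCommGroupWithZero Γ₀] [Valued K Γ₀] : NonarchimedeanRing K := by
  convert (Valued.v (R := K)).subgroups_basis.nonarchimedean using 1
  exact congrArg (fun u => u.toTopologicalSpace) (Valued.toUniformSpace_eq K Γ₀)

instance : NonarchimedeanRing SeriesAtInfty := nonarchimedeanRing_of_valued
theorem polyToSeries_injective : Function.Injective polyToSeries :=
  (algebraMap (RatFunc (ZMod 2)) SeriesAtInfty).injective.comp
    (IsFractionRing.injective _ _)

theorem two_eq_zero_seriesAtInfty : (2 : SeriesAtInfty) = 0 := by
  have h : (2 : (ZMod 2)[X]) = 0 := CharTwo.two_eq_zero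
  simpa only [map_ofNat, map_zero] using congrArg polyToSeries h

open scoped Classical in
theorem valued_polyToSeries {p : (ZMod 2)[X]} (hp : p ≠ 0) :
    Valued.v (polyToSeries p) = WithZero.exp (p.natDegree : ℤ) := by
  rw [RatFunc.valuedCompletionAtInfty.def]
  refine (@Valued.extensionValuation_apply_coe _ _ _ _ (RatFunc.inftyValued (ZMod 2)) _).trans ?_
  rw [Algebra.algebraMap_self, RingHom.id_apply, RatFunc.inftyValued.def,
    RatFunc.inftyValuation.polynomial _ hp]

theorem tendsto_inv_polyToSeries {p : ℕ → (ZMod 2)[X]}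
    (hp : ∀ n, n ≤ (p n).natDegree ∧ p n ≠ 0) :
    Tendsto (fun n => (polyToSeries (p n))⁻¹) atTop (𝓝 0) := by
  rw [(Valued.hasBasis_nhds_zero SeriesAtInfty _).tendsto_right_iff]
  intro γ _
  set g := MonoidWithZeroHom.ValueGroup₀.embedding γ.1 with hg
  have hg0 : g ≠ 0 := by simp [hg]
  obtain ⟨k, hk⟩ : ∃ k : ℤ, WithZero.exp k = g := ⟨_, WithZero.exp_log hg0⟩
  filter_upwards [eventually_gt_atTop (-k).toNat] with n hn
  rw [Valuation.restrict_lt_iff_lt_embedding, map_inv₀, valued_polyToSeries (hp n).2, ← hg, ← hk,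
    ← WithZero.exp_neg, WithZero.exp_lt_exp]
  have := (hp n).1
  omega

/-! ### Irreducibility of the quartic -/

/-- The quartic `X ^ 4 + m X + m`. -/
def blockQuartic {R : Type*} [CommRing R] (m : R) : R[X] := X ^ 4 + C m * X + C m

theorem blockQuartic_natDegree {R : Type*} [CommRing R] [Nontrivial R] (m : R) :
    (blockQuartic m).natDegree = 4 := by
  unfold blockQuartic; compute_degree!

theorem blockQuartic_monic {R : Type*} [CommRing R] [Nontrivial R] (m : R) :
    (blockQuartic m).Monic := by
  unfold blockQuartic; monicity!

theorem isUnit_add_one_of_pow_eq_mul {R : Type*} [CommRing R] {m t : R} {n : ℕ}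
    (h : t ^ n = m * (t + 1)) : IsUnit (t + 1) := by
  have hc : IsCoprime (t ^ n) (t + 1) := IsCoprime.pow_left ⟨-1, 1, by ring⟩
  rw [h] at hc
  exact isCoprime_self.1 (IsCoprime.mul_left_iff.1 hc).2

/-- The only unit of 𝔽₂[z] is 1, so t + 1 = 1. This excludes linear factors (n = 4) and quadratic
ones (n = 2). -/
theorem eq_zero_of_pow_eq_mul {m t : (ZMod 2)[X]} {n : ℕ} (h : t ^ n = m * (t + 1)) :
    t = 0 := by
  obtain ⟨r, hr, hr'⟩ := Polynomial.isUnit_iff.1 (isUnit_add_one_of_pow_eq_mul h)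
  obtain rfl : r = 1 := by
    have := hr.ne_zero
    clear hr hr'
    revert r
    decide
  simpa using hr'.symm

theorem blockQuartic_irreducible {m : (ZMod 2)[X]} (hm : m ≠ 0) :
    Irreducible (blockQuartic m) := by
  have h2 : (2 : (ZMod 2)[X]) = 0 := CharTwo.two_eq_zero
  have hroot : ∀ t, (blockQuartic m).eval t ≠ 0 := by
    intro t ht
    have h : t ^ 4 = m * (t + 1) := by
      simp only [blockQuartic, eval_add, eval_pow, eval_X, eval_mul, eval_C] at ht
      linear_combination ht - (m * t + m) * h2
    have h0 := eq_zero_of_pow_eq_mul h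
    simp [h0] at h
    exact hm h.symm
  rw [(blockQuartic_monic m).irreducible_iff_natDegree']
  refine ⟨fun h => by simpa [h] using blockQuartic_natDegree m, ?_⟩
  intro f g hf hg hfg hdeg
  rw [blockQuartic_natDegree, Finset.mem_Ioc] at hdeg
  obtain hd | hd : g.natDegree = 1 ∨ g.natDegree = 2 := by omega
  · rw [hg.as_sum, hd] at hfg
    apply hroot (-g.coeff 0)
    rw [← hfg]
    simp
  · have hfd : f.natDegree = 2 := by
      have := hf.natDegree_mul hg
      rw [hfg, blockQuartic_natDegree] at this
      omega
    rw [hg.as_sum, hf.as_sum, hd, hfd] at hfg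
    simp only [Finset.sum_range_succ, Finset.sum_range_zero, pow_zero, mul_one, pow_one,
      zero_add] at hfg
    generalize f.coeff 0 = q at hfg
    generalize f.coeff 1 = p at hfg
    generalize g.coeff 0 = r at hfg
    generalize g.coeff 1 = s at hfg
    have hfg' : (C 1 * X ^ 4 + C (p + s) * X ^ 3 + C (q + r + p * s) * X ^ 2 +
        C (p * r + q * s) * X + C (q * r) : (ZMod 2)[X][X]) =
        C 1 * X ^ 4 + C 0 * X ^ 3 + C 0 * X ^ 2 + C m * X + C m := by
      simp only [map_add, map_mul, map_zero, map_one]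
      unfold blockQuartic at hfg
      linear_combination hfg
    have c3 := congrArg (fun P => P.coeff 3) hfg'
    have c2 := congrArg (fun P => P.coeff 2) hfg'
    have c1 := congrArg (fun P => P.coeff 1) hfg'
    have c0 := congrArg (fun P => P.coeff 0) hfg'
    simp only [coeff_add, coeff_C_mul, coeff_X_pow, coeff_X, coeff_C] at c0 c1 c2 c3
    norm_num at c0 c1 c2 c3
    -- Comparing coefficients gives s = p, q + r = s², m = s³ and qr = m, whence q² = s²(q + s).
    -- Thus s divides q, and q = su leaves u² = s(u + 1).
    have hs : s = p := by linear_combination c3 - p * h2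
    subst hs
    have hp2 : q + r = s ^ 2 := by linear_combination c2 - s ^ 2 * h2
    have hp3 : m = s ^ 3 := by rw [← c1]; linear_combination s * hp2
    have hs0 : s ≠ 0 := by rintro rfl; exact hm (by simpa using hp3)
    have hq : q ^ 2 = s ^ 2 * (q + s) := by
      linear_combination q * hp2 - c0 - hp3 - s ^ 3 * h2
    obtain ⟨u, rfl⟩ : s ∣ q := (IsIntegrallyClosed.pow_dvd_pow_iff two_ne_zero).1 ⟨_, hq⟩
    have hu : u ^ 2 = s * (u + 1) := by
      apply mul_left_cancel₀ (pow_ne_zero 2 hs0)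
      linear_combination hq
    have hu0 := eq_zero_of_pow_eq_mul hu
    simp [hu0] at hu
    exact hs0 hu.symm

/-! ### Passing between T and the continued fraction -/

section Degree

variable {K L : Type*} [Field K] [Field L] [Algebra K L]

theorem sq_add_mul_add_ne_zero {T : L} (hT : (minpoly K T).natDegree = 4) (p q : K) :
    T ^ 2 + algebraMap K L p * T + algebraMap K L q ≠ 0 := by
  intro h
  have hd : (X ^ 2 + C p * X + C q : K[X]).natDegree = 2 := by compute_degree!
  have hm : (X ^ 2 + C p * X + C q : K[X]).Monic := by monicity!
  have := natDegree_le_natDegree (minpoly.min K T hm (by simpa using h))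
  omega

theorem minpoly_natDegree_eq_of_mem_adjoin {x T : L} (hT : IsIntegral K T)
    (hxT : x ∈ IntermediateField.adjoin K {T}) (hTx : T ∈ IntermediateField.adjoin K {x}) :
    IsIntegral K x ∧ (minpoly K x).natDegree = (minpoly K T).natDegree := by
  have h : IntermediateField.adjoin K {x} = IntermediateField.adjoin K {T} :=
    le_antisymm (IntermediateField.adjoin_simple_le_iff.2 hxT)
      (IntermediateField.adjoin_simple_le_iff.2 hTx)
  have : FiniteDimensional K (IntermediateField.adjoin K {T}) :=
    IntermediateField.adjoin.finiteDimensional hT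
  have hx : IsIntegral K x := by
    have := (IsIntegral.of_finite K (⟨x, hxT⟩ : IntermediateField.adjoin K {T})).map
      (IntermediateField.val _)
    simpa using this
  refine ⟨hx, ?_⟩
  rw [← IntermediateField.adjoin.finrank hx, ← IntermediateField.adjoin.finrank hT, h]

theorem blockMatrix_apply_zero_zero_ne_zero {a b : K} {T : L} (hT : (minpoly K T).natDegree = 4) :
    blockMatrix (algebraMap K L a) (algebraMap K L b) T 0 0 ≠ 0 := by
  have h := sq_add_mul_add_ne_zero hT (a * b) (a ^ 2 * b ^ 2 + a ^ 2 + a * b)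
  contrapose! h
  simp only [blockMatrix, Matrix.of_apply, Matrix.cons_val', Matrix.cons_val_zero, map_add,
    map_mul, map_pow] at h ⊢
  linear_combination h

theorem ne_one_of_mul_blockMatrix_eq {a b : K} {T x : L} (hT : (minpoly K T).natDegree = 4)
    (hx : x * blockMatrix (algebraMap K L a) (algebraMap K L b) T 0 0 =
      blockMatrix (algebraMap K L a) (algebraMap K L b) T 1 0) :
    x ≠ 1 := by
  rintro rfl
  apply sq_add_mul_add_ne_zero hT (a * b - (a + b))
    (a ^ 2 * b ^ 2 + a ^ 2 + a * b - a * b ^ 2)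
  simp [blockMatrix] at hx ⊢
  linear_combination hx

theorem mul_blockMatrix_eq (h2 : (2 : L) = 0) {a b T x : L}
    (hT : T ^ 4 + thueMorseDisc a b * T + thueMorseDisc a b = 0)
    (h0 : blockMatrix a b T 0 0 ≠ 0)
    (hx : x * blockMatrix a b T 0 0 = blockMatrix a b T 1 0) :
    x * blockMatrix a b T 1 0 = blockMatrix a b T 1 1 := by
  have : CharP L 2 := CharTwo.of_one_ne_zero_of_two_eq_zero one_ne_zero h2
  have hdet : blockMatrix a b T 0 0 * blockMatrix a b T 1 1 = blockMatrix a b T 1 0 ^ 2 := by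
    rw [thueMorseDisc] at hT
    simp [blockMatrix]
    -- In characteristic 2 the determinant of B(T) is exactly T⁴ + mT + m.
    linear_combination (norm := (ring_nf; reduce_mod_char!)) hT
  apply mul_left_cancel₀ h0
  linear_combination blockMatrix a b T 1 0 * hx - hdet

/-- Adding x times the second relation to the first gives x · tr B = (x² + 1) · B₁₀; in the trace T
cancels, and B₁₀ is linear in T. -/
theorem add_mul_sq_add_one_mul_eq (h2 : (2 : L) = 0) {a b T x : L}
    (hx : x * blockMatrix a b T 0 0 = blockMatrix a b T 1 0)
    (hx' : x * blockMatrix a b T 1 0 = blockMatrix a b T 1 1) :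
    (a + b) * (x ^ 2 + 1) * T =
      x * (a ^ 2 * b ^ 2 + a ^ 2 + b ^ 2) + a * b ^ 2 * (x ^ 2 + 1) := by
  have : CharP L 2 := CharTwo.of_one_ne_zero_of_two_eq_zero one_ne_zero h2
  simp [blockMatrix] at hx hx'
  linear_combination (norm := (ring_nf; reduce_mod_char!)) hx + x * hx'

theorem quartic_eq_zero (h2 : (2 : L) = 0) {a b T x : L}
    (hx' : x * blockMatrix a b T 1 0 = blockMatrix a b T 1 1)
    (hr : (a + b) * (x ^ 2 + 1) * T =
      x * (a ^ 2 * b ^ 2 + a ^ 2 + b ^ 2) + a * b ^ 2 * (x ^ 2 + 1)) :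
    (a * (a + b) * (a ^ 2 * b ^ 2 + a ^ 2 + b ^ 2) + a ^ 2 * b ^ 4) * x ^ 4 +
      (a * b * (a + b) * (a ^ 2 * b ^ 2 + a ^ 2 + b ^ 2)) * x ^ 3 +
      (a ^ 2 * b ^ 2 * (a ^ 2 * b ^ 2 + a ^ 2 + b ^ 2)) * x ^ 2 +
      (a * b * (a + b) * (a ^ 2 * b ^ 2 + a ^ 2 + b ^ 2)) * x +
      (b * (a + b) * (a ^ 2 * b ^ 2 + a ^ 2 + b ^ 2) + a ^ 2 * b ^ 4) = 0 := by
  have : CharP L 2 := CharTwo.of_one_ne_zero_of_two_eq_zero one_ne_zero h2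
  simp [blockMatrix] at hx'
  linear_combination (norm := (ring_nf; reduce_mod_char!)) ((a + b) * (x ^ 2 + 1)) ^ 2 * hx' +
    ((a + b) * (x ^ 2 + 1) * T + (x * (a ^ 2 * b ^ 2 + a ^ 2 + b ^ 2) + a * b ^ 2 * (x ^ 2 + 1)) +
      (a * b + x * (a + b)) * ((a + b) * (x ^ 2 + 1))) * hr

theorem isIntegral_and_natDegree_minpoly_of_mul_blockMatrix_eq (h2 : (2 : L) = 0) {a b : K}
    (hab : a ≠ b) {T x : L} (hT : (minpoly K T).natDegree = 4)
    (hx : x * blockMatrix (algebraMap K L a) (algebraMap K L b) T 0 0 =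
      blockMatrix (algebraMap K L a) (algebraMap K L b) T 1 0)
    (hr : (algebraMap K L a + algebraMap K L b) * (x ^ 2 + 1) * T =
      x * (algebraMap K L a ^ 2 * algebraMap K L b ^ 2 + algebraMap K L a ^ 2 +
        algebraMap K L b ^ 2) + algebraMap K L a * algebraMap K L b ^ 2 * (x ^ 2 + 1)) :
    IsIntegral K x ∧ (minpoly K x).natDegree = 4 := by
  have hTi : IsIntegral K T := by
    by_contra h
    rw [minpoly.eq_zero h] at hT
    simp at hT
  have h00 := blockMatrix_apply_zero_zero_ne_zero (a := a) (b := b) hT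
  -- Solving for T divides by (a + b)(x² + 1); x = 1 would make T a root of a monic quadratic over
  -- K.
  have hx1 : x ^ 2 + 1 ≠ 0 := by
    have h : x ^ 2 + 1 = (x - 1) ^ 2 := by linear_combination x * h2
    rw [h]
    exact pow_ne_zero 2 (sub_ne_zero.2 (ne_one_of_mul_blockMatrix_eq hT hx))
  have hab' : algebraMap K L a + algebraMap K L b ≠ 0 := by
    have h : algebraMap K L a + algebraMap K L b = algebraMap K L a - algebraMap K L b := by
      linear_combination algebraMap K L b * h2
    rw [h]
    exact sub_ne_zero.2 fun h => hab ((algebraMap K L).injective h)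
  rw [← hT]
  refine minpoly_natDegree_eq_of_mem_adjoin hTi ?_ ?_
  · rw [eq_div_of_mul_eq h00 hx]
    have hmem : T ∈ IntermediateField.adjoin K {T} := IntermediateField.mem_adjoin_simple_self K T
    generalize IntermediateField.adjoin K {T} = F at hmem
    simp only [blockMatrix, Matrix.of_apply, Matrix.cons_val', Matrix.cons_val_zero,
      Matrix.cons_val_one, Matrix.cons_val_fin_one]
    apply_rules [F.div_mem, F.add_mem, F.mul_mem, pow_mem, F.algebraMap_mem]
  · rw [eq_div_of_mul_eq (mul_ne_zero hab' hx1) ((mul_comm _ _).trans hr)]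
    have hmem : x ∈ IntermediateField.adjoin K {x} := IntermediateField.mem_adjoin_simple_self K x
    generalize IntermediateField.adjoin K {x} = F at hmem
    apply_rules [F.div_mem, F.add_mem, F.mul_mem, pow_mem, F.algebraMap_mem, F.one_mem]

end Degree

/-! ### Limits and conclusion -/

theorem natDegree_minpoly_of_quartic {m : (ZMod 2)[X]} (hm : m ≠ 0) {T : SeriesAtInfty}
    (hT : T ^ 4 + polyToSeries m * T + polyToSeries m = 0) :
    (minpoly (RatFunc (ZMod 2)) T).natDegree = 4 := by
  have hirr := ((blockQuartic_monic m).irreducible_iff_irreducible_map_fraction_map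
    (K := RatFunc (ZMod 2))).1 (blockQuartic_irreducible hm)
  have hmon := (blockQuartic_monic m).map (algebraMap (ZMod 2)[X] (RatFunc (ZMod 2)))
  have haev : aeval T ((blockQuartic m).map (algebraMap (ZMod 2)[X] (RatFunc (ZMod 2)))) = 0 := by
    simpa [blockQuartic, polyToSeries] using hT
  rw [← minpoly.eq_of_irreducible_of_monic hirr haev hmon, (blockQuartic_monic m).natDegree_map,
    blockQuartic_natDegree]

theorem tendsto_convs_ofStream {f : ℕ → (ZMod 2)[X]} (hf : ∀ n, 0 < (f n).natDegree) :
    ∃ x, Tendsto (⟨0, Stream'.Seq.ofStream fun n => ⟨1, polyToSeries (f n)⟩⟩ :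
      GenContFract SeriesAtInfty).convs atTop (𝓝 x) := by
  apply cauchySeq_tendsto_of_complete
  apply NonarchimedeanAddGroup.cauchySeq_of_tendsto_sub_nhds_zero
  have hq := natDegree_contProd f hf
  have hmap (n : ℕ) : contProd (fun i => polyToSeries (f i)) n 0 0 =
      polyToSeries (contProd f n 0 0) := by rw [map_contProd, Matrix.map_apply]
  have hne (n : ℕ) : contProd (fun i => polyToSeries (f i)) n 0 0 ≠ 0 := by
    rw [hmap]
    exact (map_ne_zero_iff _ polyToSeries_injective).2 (hq n).2
  refine (tendsto_inv_polyToSeries (p := fun n => contProd f n 0 0 * contProd f (n + 1) 0 0)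
    fun n => ⟨?_, mul_ne_zero (hq n).2 (hq (n + 1)).2⟩).congr fun n => ?_
  · rw [natDegree_mul (hq n).2 (hq (n + 1)).2]
    exact le_add_right (hq n).1
  · rw [convs_ofStream, convs_ofStream, convs_ofStream_succ_sub _ n (hne n) (hne (n + 1)), hmap,
      hmap, map_mul, show (-1 : SeriesAtInfty) = 1 by linear_combination -two_eq_zero_seriesAtInfty,
      one_pow, one_div]

theorem tendsto_blockParam {m : (ZMod 2)[X]} (hm : 0 < m.natDegree) :
    ∃ T, Tendsto (blockParam (polyToSeries m)) atTop (𝓝 T) ∧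
      T ^ 4 + polyToSeries m * T + polyToSeries m = 0 := by
  have hm0 : m ≠ 0 := fun h => by simp [h] at hm
  have hm0' : polyToSeries m ≠ 0 := (map_ne_zero_iff _ polyToSeries_injective).2 hm0
  have hc := natDegree_blockScale m hm
  obtain ⟨T, hT⟩ : ∃ T, Tendsto (blockParam (polyToSeries m)) atTop (𝓝 T) := by
    apply cauchySeq_tendsto_of_complete
    apply NonarchimedeanAddGroup.cauchySeq_of_tendsto_sub_nhds_zero
    refine (tendsto_inv_polyToSeries (p := fun n => m * blockScale m n ^ 2)
      fun n => ⟨?_, mul_ne_zero hm0 (pow_ne_zero 2 (hc n).2)⟩).congr fun n => ?_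
    · rw [natDegree_mul hm0 (pow_ne_zero 2 (hc n).2), natDegree_pow]
      have := (hc n).1
      omega
    · rw [blockParam_succ_sub two_eq_zero_seriesAtInfty hm0', map_mul, map_pow, map_blockScale]
  refine ⟨T, hT, ?_⟩
  have h : T = 1 + T ^ 4 / polyToSeries m :=
    tendsto_nhds_unique ((tendsto_add_atTop_iff_nat 1).2 hT)
      (tendsto_const_nhds.add ((hT.pow 4).div_const _))
  have h' : polyToSeries m * T = polyToSeries m + T ^ 4 := by
    conv_lhs => rw [h]
    field_simp
  linear_combination h' + (T ^ 4 + polyToSeries m) * two_eq_zero_seriesAtInfty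

theorem natDegree_thueMorseDisc_pos {a b : (ZMod 2)[X]} (ha : 0 < a.natDegree)
    (hb : 0 < b.natDegree) : 0 < (thueMorseDisc a b).natDegree := by
  have ha0 : a ≠ 0 := fun h => by simp [h] at ha
  have hb0 : b ≠ 0 := fun h => by simp [h] at hb
  -- In characteristic 2, m = ab(ab + a + b)²; the last factor is (a + 1)(b + 1) - 1, nonzero since
  -- a + 1 is not a unit.
  have h0 : a * b + (a + b) ≠ 0 := by
    intro h
    have h1 : (a + 1) * (b + 1) = 1 := by linear_combination h
    have := natDegree_mul (left_ne_zero_of_mul_eq_one h1) (right_ne_zero_of_mul_eq_one h1)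
    rw [h1, natDegree_one, ← C_1, natDegree_add_C, natDegree_add_C] at this
    omega
  have h : thueMorseDisc a b = a * b * (a * b + (a + b)) ^ 2 := by
    rw [thueMorseDisc, CharTwo.add_sq, CharTwo.add_sq]
    ring
  rw [h, natDegree_mul (mul_ne_zero ha0 hb0) (pow_ne_zero 2 h0), natDegree_mul ha0 hb0]
  omega

theorem thueMorseSeries_mul_blockMatrix_eq {a b : (ZMod 2)[X]} {x T : SeriesAtInfty}
    (hmdeg : 0 < (thueMorseDisc a b).natDegree)
    (hlim : Tendsto (thueMorseContFract a b).convs atTop (𝓝 x))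
    (hT : Tendsto (blockParam (polyToSeries (thueMorseDisc a b))) atTop (𝓝 T))
    (h00 : blockMatrix (polyToSeries a) (polyToSeries b) T 0 0 ≠ 0) :
    x * blockMatrix (polyToSeries a) (polyToSeries b) T 0 0 =
      blockMatrix (polyToSeries a) (polyToSeries b) T 1 0 := by
  have hm0 : thueMorseDisc a b ≠ 0 := fun h => by simp [h] at hmdeg
  have hmap : polyToSeries (thueMorseDisc a b) =
      thueMorseDisc (polyToSeries a) (polyToSeries b) := by simp [thueMorseDisc]
  have hm0' : thueMorseDisc (polyToSeries a) (polyToSeries b) ≠ 0 := by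
    rw [← hmap]
    exact (map_ne_zero_iff _ polyToSeries_injective).2 hm0
  rw [hmap] at hT
  rw [← eq_div_iff h00]
  -- All convergents tend to x, so the subsequence of indices 4^(n+1) identifies the limit; there
  -- the scale factor cancels in the quotient.
  have hsub : Tendsto (fun n : ℕ => 2 ^ (2 * n + 2)) atTop atTop :=
    tendsto_atTop_mono (fun n => (show n ≤ 2 * n + 2 by omega).trans
      (2 * n + 2).lt_two_pow_self.le) tendsto_id
  have hconv (n : ℕ) : (thueMorseContFract a b).convs (2 ^ (2 * n + 2)) =
      blockMatrix (polyToSeries a) (polyToSeries b)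
          (blockParam (thueMorseDisc (polyToSeries a) (polyToSeries b)) n) 1 0 /
        blockMatrix (polyToSeries a) (polyToSeries b)
          (blockParam (thueMorseDisc (polyToSeries a) (polyToSeries b)) n) 0 0 := by
    have hc : blockScale (thueMorseDisc (polyToSeries a) (polyToSeries b)) n ≠ 0 := by
      rw [← hmap, ← map_blockScale]
      exact (map_ne_zero_iff _ polyToSeries_injective).2 (natDegree_blockScale _ hmdeg n).2
    rw [thueMorseContFract, convs_ofStream, map_thueMorseWord,
      contProd_thueMorseWord_eq_smul_blockMatrix two_eq_zero_seriesAtInfty _ _ hm0',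
      Matrix.smul_apply, Matrix.smul_apply, smul_eq_mul, smul_eq_mul, mul_div_mul_left _ _ hc]
  have hcont (i j : Fin 2) : Continuous fun t : SeriesAtInfty =>
      blockMatrix (polyToSeries a) (polyToSeries b) t i j := by
    fin_cases i <;> fin_cases j <;> simp [blockMatrix] <;> fun_prop
  refine tendsto_nhds_unique ((hlim.comp hsub).congr hconv) ?_
  exact (((hcont 1 0).tendsto T).comp hT).div (((hcont 0 0).tendsto T).comp hT) h00

theorem theorem1 (a b : (ZMod 2)[X]) (ha : 0 < a.natDegree) (hb : 0 < b.natDegree)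
    (hab : a ≠ b) :
    Tendsto (thueMorseContFract a b).convs atTop (𝓝 (thueMorseSeries a b)) ∧
    IsAlgebraic (RatFunc (ZMod 2)) (thueMorseSeries a b) ∧
    (minpoly (RatFunc (ZMod 2)) (thueMorseSeries a b)).natDegree = 4 ∧
    polyToSeries (coeffA4 a b) * thueMorseSeries a b ^ 4 +
      polyToSeries (coeffA3 a b) * thueMorseSeries a b ^ 3 +
      polyToSeries (coeffA2 a b) * thueMorseSeries a b ^ 2 +
      polyToSeries (coeffA1 a b) * thueMorseSeries a b +
      polyToSeries (coeffA0 a b) = 0 := by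
  have h2 := two_eq_zero_seriesAtInfty
  have hw (n : ℕ) : 0 < (thueMorseWord a b n).natDegree := by
    unfold thueMorseWord; split_ifs <;> assumption
  have hlim : Tendsto (thueMorseContFract a b).convs atTop (𝓝 (thueMorseSeries a b)) :=
    tendsto_nhds_limUnder (tendsto_convs_ofStream hw)
  refine ⟨hlim, ?_⟩
  have hmdeg := natDegree_thueMorseDisc_pos ha hb
  have hm0 : thueMorseDisc a b ≠ 0 := fun h => by simp [h] at hmdeg
  have hmap : polyToSeries (thueMorseDisc a b) =
      thueMorseDisc (polyToSeries a) (polyToSeries b) := by simp [thueMorseDisc]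
  obtain ⟨T, hT, hTq⟩ := tendsto_blockParam hmdeg
  have hdeg := natDegree_minpoly_of_quartic hm0 hTq
  have h00 : blockMatrix (polyToSeries a) (polyToSeries b) T 0 0 ≠ 0 :=
    blockMatrix_apply_zero_zero_ne_zero (a := algebraMap (ZMod 2)[X] (RatFunc (ZMod 2)) a)
      (b := algebraMap (ZMod 2)[X] (RatFunc (ZMod 2)) b) hdeg
  have hx := thueMorseSeries_mul_blockMatrix_eq hmdeg hlim hT h00
  rw [hmap] at hTq
  generalize thueMorseSeries a b = x at hx ⊢
  have hx' := mul_blockMatrix_eq h2 hTq h00 hx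
  have hr := add_mul_sq_add_one_mul_eq h2 hx hx'
  have hmin := isIntegral_and_natDegree_minpoly_of_mul_blockMatrix_eq h2
    (a := algebraMap (ZMod 2)[X] (RatFunc (ZMod 2)) a)
    (b := algebraMap (ZMod 2)[X] (RatFunc (ZMod 2)) b)
    (fun h => hab (IsFractionRing.injective (ZMod 2)[X] (RatFunc (ZMod 2)) h)) hdeg hx hr
  refine ⟨hmin.1.isAlgebraic, hmin.2, ?_⟩
  simpa only [coeffA0, coeffA1, coeffA2, coeffA3, coeffA4, map_add, map_mul, map_pow] using
    quartic_eq_zero h2 hx' hr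

end
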